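/- For a partition $\pi$ of a positive integer, let $l(\pi)$ be its largest part, $\#(\pi)$ its number of parts (counted with multiplicity), $L(\pi)$ the number of times its largest part appears, and $\nu_d(\pi)$ the number of different part sizes (the number of parts without multiplicity). Let $n\ge 1$ be an integer, let $\mathcal P(n)$ be the set of all partitions of $n$, and let $z,c$ be nonzero complex numbers. Then $$\sum_{\pi\in\mathcal P(n)} z^{l(\pi)+\#(\pi)-L(\pi)}\left(1-\frac1z\right)^{\nu_d(\pi)-1}\left(\frac{z^{L(\pi)}-c^{L(\pi)}}{z-c}\right)=\sum_{\pi\in\mathcal P(n)} c^{l(\pi)-1}z^{\#(\pi)}\left(1-\frac1c\right)^{\nu_d(\pi)-1}L(\pi),$$ where for $z=c$ the quotient $\frac{z^{L(\pi)}-c^{L(\pi)}}{z-c}$ is read as its limit $L(\pi)z^{L(\pi)-1}$, and $w^0=1$ for every complex $w$. -/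

import Mathlib

namespace Nat.Partition

/-- The largest part `l(π)` of a partition (and `0` for the empty partition of `0`). -/
def largestPart {n : ℕ} (π : n.Partition) : ℕ := π.parts.sup

/-- The number of parts `#(π)`, counted with multiplicity. -/
def numParts {n : ℕ} (π : n.Partition) : ℕ := Multiset.card π.parts

/-- The number `L(π)` of appearances of the largest part. -/
def largestMult {n : ℕ} (π : n.Partition) : ℕ := π.parts.count π.largestPart

/-- The number of parts without multiplicity `ν_d(π)`, i.e. the number of different part sizes. -/
def numDistinctParts {n : ℕ} (π : n.Partition) : ℕ := π.parts.toFinset.card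

/-! The subtractions of natural numbers `l + # - L`, `ν_d - 1` and `l - 1` are never truncated for a
partition of a positive integer, by the following facts. -/

theorem largestMult_le_numParts {n : ℕ} (π : n.Partition) : π.largestMult ≤ π.numParts :=
  Multiset.count_le_card _ _

theorem parts_ne_zero {n : ℕ} (hn : 1 ≤ n) (π : n.Partition) : π.parts ≠ 0 := by
  intro h
  have h2 := π.parts_sum
  rw [h, Multiset.sum_zero] at h2
  omega

theorem one_le_numDistinctParts {n : ℕ} (hn : 1 ≤ n) (π : n.Partition) :
    1 ≤ π.numDistinctParts := by
  obtain ⟨a, ha⟩ := Multiset.exists_mem_of_ne_zero (parts_ne_zero hn π)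
  exact Finset.card_pos.mpr ⟨a, Multiset.mem_toFinset.mpr ha⟩

theorem one_le_largestPart {n : ℕ} (hn : 1 ≤ n) (π : n.Partition) : 1 ≤ π.largestPart := by
  obtain ⟨a, ha⟩ := Multiset.exists_mem_of_ne_zero (parts_ne_zero hn π)
  exact le_trans (π.parts_pos ha) (Multiset.le_sup ha)

end Nat.Partition

/-!
Both sides are sums over partitions sorted by their largest part `N`. In a product over part sizes a
part `j < N` occurring `m ≥ 1` times contributes `(1 - 1 / w) z ^ m`, so it gives the factor
`(1 - (z / w) q ^ j) / (1 - z q ^ j)`, with `w = z` on the left and `w = c` on the right; the largest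
part contributes a product of two geometric series (`Nat.Partition.sum_eq_coeff`,
`Nat.Partition.one_sub_mul_one_sub_mul_multSeries`). The theorem is therefore the coefficient of
`q ^ n` in

`∑_N (z q) ^ N (q; q)_{N-1} / ((z q; q)_N (1 - c q ^ N))
  = ∑_N z q ^ N ∏_{0 < j < N} (c - z q ^ j) / ((z q; q)_{N-1} (1 - z q ^ N) ^ 2)`.

The right-hand side is the Newton interpolation series in `c`, with nodes `z q, z q², …`, of the
left-hand side: each `1 / (1 - c q ^ M)` on the left is expanded by `newton_expansion`, and after
exchanging the two sums the inner sum over `M` telescopes (`telescoping_sum`). Everything takes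
place modulo `q ^ (n + 1)`, where all the sums are finite (`pow_dvd_partialSum_sub`).
-/

/-! ### The Newton expansion and the `q`-series identity -/

section NewtonExpansion

variable {R : Type*} [CommRing R] {z c q : R} {e f : ℕ → R}

/-- Newton's interpolation formula, with remainder, for `x ↦ 1 / (1 - x q ^ M)` at the nodes
`z q, z q², …`, evaluated at `x = c`. Here `e j = 1 / (1 - z q ^ j)` and `a = 1 / (1 - c q ^ M)`. -/
theorem newton_expansion (he : ∀ j, 1 ≤ j → (1 - z * q ^ j) * e j = 1) {M : ℕ} {a : R}
    (ha : (1 - c * q ^ M) * a = 1) (K : ℕ) :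
    a = ∑ k ∈ Finset.range K, q ^ (M * k) * (∏ j ∈ Finset.range k, (c - z * q ^ (j + 1)))
          * ∏ j ∈ Finset.range (k + 1), e (M + j + 1)
      + q ^ (M * K) * (∏ j ∈ Finset.range K, (c - z * q ^ (j + 1)))
          * (∏ j ∈ Finset.range K, e (M + j + 1)) * a := by
  induction K with
  | zero => simp
  | succ K ih =>
    rw [Finset.sum_range_succ, Finset.prod_range_succ (fun j => c - z * q ^ (j + 1)) K,
      Finset.prod_range_succ (fun j => e (M + j + 1)) K]
    have h := he (M + K + 1) (by omega)
    -- The difference of two consecutive partial expansions vanishes by this resolvent identity.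
    have hres : a = e (M + K + 1) + q ^ M * (c - z * q ^ (K + 1)) * e (M + K + 1) * a := by
      have : q ^ (M + K + 1) = q ^ M * q ^ (K + 1) := by ring
      rw [this] at h
      linear_combination e (M + K + 1) * ha + (-a) * h
    rw [show q ^ (M * (K + 1)) = q ^ (M * K) * q ^ M by ring]
    linear_combination ih + q ^ (M * K) * (∏ j ∈ Finset.range K, (c - z * q ^ (j + 1)))
          * (∏ j ∈ Finset.range K, e (M + j + 1)) * hres

/-- Telescoping evaluation of the coefficients of the Newton expansion: in the limit `K → ∞` the sum
of `(z q ^ (k+1)) ^ M (q; q)_{M-1} / (z q; q)_{M+k+1}` over `M ≥ 1` is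
`z q ^ (k+1) / ((1 - z q ^ (k+1)) (z q; q)_{k+1})`. The summation index is `M - 1`. -/
theorem telescoping_sum (he : ∀ j, 1 ≤ j → (1 - z * q ^ j) * e j = 1) (k K : ℕ) :
    ∑ M ∈ Finset.range K, (z * q ^ (k + 1)) ^ (M + 1) * (∏ j ∈ Finset.range M, (1 - q ^ (j + 1)))
        * ∏ j ∈ Finset.range (M + k + 2), e (j + 1)
      = e (k + 1) * (z * q ^ (k + 1) * ∏ j ∈ Finset.range (k + 1), e (j + 1)
        - (z * q ^ (k + 1)) ^ (K + 1) * (∏ j ∈ Finset.range K, (1 - q ^ (j + 1)))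
          * ∏ j ∈ Finset.range (K + k + 1), e (j + 1)) := by
  induction K with
  | zero => simp
  | succ K ih =>
    rw [Finset.sum_range_succ, ih, Finset.prod_range_succ (fun j => 1 - q ^ (j + 1)) K,
      show K + 1 + k + 1 = K + k + 1 + 1 by omega, show K + k + 2 = K + k + 1 + 1 by omega,
      Finset.prod_range_succ (fun j => e (j + 1)) (K + k + 1)]
    have h1 := he (k + 1) (by omega)
    have h2 := he (K + k + 1 + 1) (by omega)
    rw [show q ^ (K + k + 1 + 1) = q ^ (k + 1) * q ^ (K + 1) by ring] at h2
    generalize ∏ j ∈ Finset.range K, (1 - q ^ (j + 1)) = Q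
    generalize ∏ j ∈ Finset.range (K + k + 1), e (j + 1) = P
    generalize e (K + k + 1 + 1) = e₂ at *
    generalize e (k + 1) = e₁ at *
    rw [pow_succ (z * q ^ (k + 1)) (K + 1)]
    generalize (z * q ^ (k + 1)) ^ (K + 1) = Y
    linear_combination (-Y * Q * P * e₂) * h1 + (Y * Q * P * e₁) * h2

/-- A transformation of basic hypergeometric series: the sum over `N ≥ 1` of
`(z q) ^ N (q; q)_{N-1} / ((z q; q)_N (1 - c q ^ N))` agrees with the sum of
`z q ^ N ∏_{0 < j < N} (c - z q ^ j) / ((z q; q)_{N-1} (1 - z q ^ N) ^ 2)`, here as a congruence of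
partial sums modulo a power of `q`. The reciprocals of `1 - z q ^ j` and `1 - c q ^ j` are `e j` and
`f j`. -/
theorem pow_dvd_partialSum_sub (he : ∀ j, 1 ≤ j → (1 - z * q ^ j) * e j = 1)
    (hf : ∀ j, 1 ≤ j → (1 - c * q ^ j) * f j = 1) (n : ℕ) :
    q ^ (n + 1) ∣
      ∑ N ∈ Finset.range n, z ^ (N + 1) * (q ^ (N + 1) * e (N + 1) * f (N + 1))
          * ∏ j ∈ Finset.range N, (1 - q ^ (j + 1)) * e (j + 1)
      - ∑ N ∈ Finset.range n, (z * q ^ (N + 1) * e (N + 1) ^ 2)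
          * ∏ j ∈ Finset.range N, (c - z * q ^ (j + 1)) * e (j + 1) := by
  have hprod (M k : ℕ) : (∏ j ∈ Finset.range M, e (j + 1)) * e (M + 1)
      * ∏ j ∈ Finset.range (k + 1), e (M + 1 + j + 1)
      = ∏ j ∈ Finset.range (M + k + 2), e (j + 1) := by
    rw [show M + k + 2 = M + 1 + (k + 1) by omega,
      Finset.prod_range_add (fun j => e (j + 1)), Finset.prod_range_succ _ M]
  have hexp (M : ℕ) : z ^ (M + 1) * (q ^ (M + 1) * e (M + 1) * f (M + 1))
        * ∏ j ∈ Finset.range M, (1 - q ^ (j + 1)) * e (j + 1)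
      = ∑ k ∈ Finset.range n, (∏ j ∈ Finset.range k, (c - z * q ^ (j + 1)))
          * ((z * q ^ (k + 1)) ^ (M + 1) * (∏ j ∈ Finset.range M, (1 - q ^ (j + 1)))
            * ∏ j ∈ Finset.range (M + k + 2), e (j + 1))
        + q ^ (n + 1) * (q ^ (M * n + M) * z ^ (M + 1) * e (M + 1)
          * (∏ j ∈ Finset.range M, (1 - q ^ (j + 1)) * e (j + 1))
          * (∏ j ∈ Finset.range n, (c - z * q ^ (j + 1)))
          * (∏ j ∈ Finset.range n, e (M + 1 + j + 1)) * f (M + 1)) := by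
    have h := newton_expansion he (hf (M + 1) (by omega)) n
    nth_rewrite 1 [h]
    rw [mul_add, mul_add, add_mul]
    congr 1
    · rw [Finset.mul_sum, Finset.mul_sum, Finset.sum_mul]
      refine Finset.sum_congr rfl fun k _ => ?_
      rw [← hprod, Finset.prod_mul_distrib]
      ring
    · ring
  have htail (k : ℕ) : (z * q ^ (k + 1) * e (k + 1) ^ 2)
        * ∏ j ∈ Finset.range k, (c - z * q ^ (j + 1)) * e (j + 1)
      = (∏ j ∈ Finset.range k, (c - z * q ^ (j + 1)))
          * (e (k + 1) * (z * q ^ (k + 1) * ∏ j ∈ Finset.range (k + 1), e (j + 1))) := by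
    rw [Finset.prod_range_succ, Finset.prod_mul_distrib]
    ring
  simp_rw [hexp, htail]
  rw [Finset.sum_add_distrib, Finset.sum_comm]
  simp_rw [← Finset.mul_sum, telescoping_sum he]
  rw [add_sub_right_comm, ← Finset.sum_sub_distrib]
  refine dvd_add (Finset.dvd_sum fun k _ => ?_) (dvd_mul_right _ _)
  rw [← mul_sub, mul_sub (e (k + 1)), sub_sub_cancel_left]
  refine Dvd.dvd.mul_left ?_ _
  rw [dvd_neg]
  refine Dvd.dvd.mul_left (Dvd.dvd.mul_right (Dvd.dvd.mul_right ?_ _) _) _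
  rw [mul_pow]
  exact Dvd.dvd.mul_left (pow_dvd_pow_of_dvd (dvd_pow_self q (by omega)) _) _

end NewtonExpansion

/-! ### Partitions sorted by their largest part -/

namespace Nat.Partition

section LargestPart

variable {R : Type*} [CommRing R]

/-- The character, in the sense of `Nat.Partition.genFun`, that weighs a part `i` of multiplicity `m`
by `f m` if `i < N` and by `g m` if `i = N`, and forbids parts greater than `N`. With `g = 0` the
part `N` is forbidden too. -/
def capChar (f g : ℕ → R) (N i m : ℕ) : R := if i < N then f m else if i = N then g m else 0

theorem largestPart_mem {n : ℕ} (hn : 1 ≤ n) (π : n.Partition) :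
    π.largestPart ∈ π.parts.toFinset := by
  obtain ⟨a, ha, h⟩ := Finset.exists_mem_eq_sup π.parts.toFinset
    (Finset.card_pos.mp (one_le_numDistinctParts hn π)) id
  rw [Finset.sup_def, Multiset.map_id, Multiset.toFinset_val, Multiset.sup_dedup] at h
  rw [largestPart, h]
  exact ha

theorem le_largestPart {n : ℕ} (π : n.Partition) {i : ℕ} (hi : i ∈ π.parts.toFinset) :
    i ≤ π.largestPart :=
  Multiset.le_sup (Multiset.mem_toFinset.mp hi)

theorem largestPart_le {n : ℕ} (π : n.Partition) : π.largestPart ≤ n := by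
  refine Multiset.sup_le.mpr fun i hi => ?_
  exact (Multiset.single_le_sum (fun _ _ => Nat.zero_le _) i hi).trans_eq π.parts_sum

/-- Subtracting the partitions all of whose parts are less than `N` from those whose parts are at
most `N` isolates the partitions with largest part exactly `N`. -/
theorem prod_capChar_sub {n : ℕ} (hn : 1 ≤ n) (f g : ℕ → R) (N : ℕ) (π : n.Partition) :
    π.parts.toFinsupp.prod (capChar f g N) - π.parts.toFinsupp.prod (capChar f 0 N)
      = if π.largestPart = N then
          g π.largestMult * ∏ i ∈ π.parts.toFinset.erase π.largestPart, f (π.parts.count i)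
        else 0 := by
  simp only [Finsupp.prod, Multiset.toFinsupp_support, Multiset.toFinsupp_apply]
  have hmem := largestPart_mem hn π
  rw [← Finset.mul_prod_erase _ _ hmem, ← Finset.mul_prod_erase _ _ hmem]
  have hlt : ∀ i ∈ π.parts.toFinset.erase π.largestPart, i < π.largestPart := fun i hi =>
    lt_of_le_of_ne (le_largestPart π (Finset.mem_of_mem_erase hi)) (Finset.ne_of_mem_erase hi)
  rcases lt_trichotomy π.largestPart N with h | h | h
  · rw [if_neg h.ne, sub_eq_zero]
    congr 1
    · simp [capChar, h]
    · refine Finset.prod_congr rfl fun i hi => ?_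
      simp [capChar, (hlt i hi).trans h]
  · subst h
    rw [if_pos rfl]
    have : ∀ g' : ℕ → R, ∏ i ∈ π.parts.toFinset.erase π.largestPart,
        capChar f g' π.largestPart i (π.parts.count i)
        = ∏ i ∈ π.parts.toFinset.erase π.largestPart, f (π.parts.count i) := fun g' =>
      Finset.prod_congr rfl fun i hi => by simp [capChar, hlt i hi]
    rw [this, this]
    simp [capChar, largestMult]
  · rw [if_neg h.ne']
    simp [capChar, h.not_gt, h.ne']

open PowerSeries
open scoped PowerSeries.WithPiTopology

variable [TopologicalSpace R] [T2Space R]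

/-- The power series `∑ g(m) X ^ (i m)`, over `m ≥ 1`, which records the multiplicities of the part
`i`. -/
noncomputable def multSeries (g : ℕ → R) (i : ℕ) : R⟦X⟧ :=
  ∑' j, g (j + 1) • (X : R⟦X⟧) ^ (i * (j + 1))

theorem genFun_capChar (f g : ℕ → R) (N : ℕ) :
    genFun (capChar f g (N + 1))
      = (1 + multSeries g (N + 1)) * ∏ j ∈ Finset.range N, (1 + multSeries f (j + 1)) := by
  rw [genFun_eq_tprod, tprod_eq_prod (s := Finset.range (N + 1)), Finset.prod_range_succ, mul_comm]
  · congr 1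
    · simp [capChar, multSeries]
    · refine Finset.prod_congr rfl fun j hj => ?_
      simp [capChar, multSeries, Finset.mem_range.mp hj]
  · intro i hi
    have h : N < i := by
      rw [Finset.mem_range] at hi
      omega
    simp [capChar, h.not_gt, h.ne']

/-- A sum over partitions of `n ≥ 1`, weighted by the largest part, its multiplicity and the
multiplicities of the smaller parts, as a coefficient of a power series. The summation index `N` is
the largest part minus one. -/
theorem sum_eq_coeff {n : ℕ} (hn : 1 ≤ n) (f g r : ℕ → R) :
    ∑ π : n.Partition, r π.largestPart
        * (g π.largestMult * ∏ i ∈ π.parts.toFinset.erase π.largestPart, f (π.parts.count i))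
      = coeff n (∑ N ∈ Finset.range n, C (r (N + 1))
          * (multSeries g (N + 1) * ∏ j ∈ Finset.range N, (1 + multSeries f (j + 1)))) := by
  have hdiff (N : ℕ) : multSeries g (N + 1) * ∏ j ∈ Finset.range N, (1 + multSeries f (j + 1))
      = genFun (capChar f g (N + 1)) - genFun (capChar f 0 (N + 1)) := by
    rw [genFun_capChar, genFun_capChar]
    have : multSeries (0 : ℕ → R) (N + 1) = 0 := by simp [multSeries]
    rw [this]
    ring
  simp_rw [hdiff, map_sum, coeff_C_mul, map_sub, coeff_genFun, ← Finset.sum_sub_distrib,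
    prod_capChar_sub hn, Finset.mul_sum]
  rw [Finset.sum_comm]
  refine Finset.sum_congr rfl fun π _ => ?_
  have h1 := one_le_largestPart hn π
  have h2 := largestPart_le π
  rw [Finset.sum_eq_single (π.largestPart - 1)]
  · rw [Nat.sub_add_cancel h1, if_pos rfl]
  · intro N _ hN
    rw [if_neg (by omega), mul_zero]
  · intro h
    exact absurd (Finset.mem_range.mpr (by omega)) h

variable [IsTopologicalRing R]

theorem multSeries_eq_add (g : ℕ → R) {i : ℕ} (hi : i ≠ 0) :
    multSeries g i = C (g 1) * X ^ i + X ^ i * multSeries (fun m => g (m + 1)) i := by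
  have hs := summable_genFun_term' (fun _ m => g m) hi
  have hs' := summable_genFun_term' (fun _ m => g (m + 1)) hi
  rw [multSeries, hs.tsum_eq_zero_add, multSeries, ← hs'.tsum_mul_left]
  congr 1
  · simp [smul_eq_C_mul]
  · refine tsum_congr fun j => ?_
    rw [mul_smul_comm, ← pow_add]
    congr 2
    ring

theorem multSeries_add (g h : ℕ → R) {i : ℕ} (hi : i ≠ 0) :
    multSeries (fun m => g m + h m) i = multSeries g i + multSeries h i := by
  simp only [multSeries, add_smul]
  exact (summable_genFun_term' (fun _ m => g m) hi).tsum_add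
    (summable_genFun_term' (fun _ m => h m) hi)

theorem multSeries_const_mul (a : R) (g : ℕ → R) {i : ℕ} (hi : i ≠ 0) :
    multSeries (fun m => a * g m) i = C a * multSeries g i := by
  rw [multSeries, multSeries, ← (summable_genFun_term' (fun _ m => g m) hi).tsum_mul_left]
  refine tsum_congr fun j => ?_
  rw [mul_smul, smul_eq_C_mul]

theorem one_sub_mul_multSeries_pow (z : R) {i : ℕ} (hi : i ≠ 0) :
    (1 - C z * X ^ i) * multSeries (fun m => z ^ m) i = C z * X ^ i := by
  have h := multSeries_eq_add (fun m => z ^ m) hi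
  simp only [_root_.pow_succ', pow_zero, mul_one] at h
  rw [multSeries_const_mul z (fun m => z ^ m) hi] at h
  linear_combination h

/-- The complete homogeneous polynomial `∑_{i + j = m - 1} z ^ i c ^ j`, which is
`(z ^ m - c ^ m) / (z - c)` for `z ≠ c` and `m z ^ (m - 1)` for `z = c`, has a product of two
geometric series as its generating function. -/
theorem one_sub_mul_one_sub_mul_multSeries (z c : R) {i : ℕ} (hi : i ≠ 0) :
    (1 - C z * X ^ i) * (1 - C c * X ^ i)
      * multSeries (fun m => ∑ j ∈ Finset.range m, z ^ j * c ^ (m - 1 - j)) i = X ^ i := by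
  have h := multSeries_eq_add (fun m => ∑ j ∈ Finset.range m, z ^ j * c ^ (m - 1 - j)) hi
  have hrec : (fun m => ∑ j ∈ Finset.range (m + 1), z ^ j * c ^ (m + 1 - 1 - j))
      = fun m => z * (∑ j ∈ Finset.range m, z ^ j * c ^ (m - 1 - j)) + c ^ m := by
    funext m
    rw [Finset.sum_range_succ', Finset.mul_sum]
    congr 1
    · refine Finset.sum_congr rfl fun j _ => ?_
      rw [_root_.pow_succ', mul_assoc, show m + 1 - 1 - (j + 1) = m - 1 - j by omega]
    · simp
  rw [hrec, multSeries_add _ _ hi, multSeries_const_mul _ _ hi] at h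
  simp only [Finset.range_one, Finset.sum_singleton, pow_zero, mul_one, map_one, Nat.sub_self,
    one_mul] at h
  linear_combination (1 - C c * X ^ i) * h + X ^ i * one_sub_mul_multSeries_pow c hi

end LargestPart

theorem prod_erase_largestPart {n : ℕ} (hn : 1 ≤ n) (u z : ℂ) (π : n.Partition) :
    ∏ i ∈ π.parts.toFinset.erase π.largestPart, u * z ^ π.parts.count i
      = u ^ (π.numDistinctParts - 1) * z ^ (π.numParts - π.largestMult) := by
  have hmem := largestPart_mem hn π
  have hcard : π.numParts = π.largestMult
      + ∑ i ∈ π.parts.toFinset.erase π.largestPart, π.parts.count i := by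
    rw [numParts, ← Multiset.toFinset_sum_count_eq, largestMult,
      Finset.add_sum_erase _ (fun i => π.parts.count i) hmem]
  rw [Finset.prod_mul_distrib, Finset.prod_const, Finset.card_erase_of_mem hmem,
    Finset.prod_pow_eq_pow_sum, hcard, Nat.add_sub_cancel_left, numDistinctParts]

open PowerSeries in
theorem one_sub_mul_inv (a : ℂ) {i : ℕ} (hi : 1 ≤ i) :
    (1 - C a * (X : ℂ⟦X⟧) ^ i) * (1 - C a * (X : ℂ⟦X⟧) ^ i)⁻¹ = 1 :=
  PowerSeries.mul_inv_cancel _ (by simp [Nat.one_le_iff_ne_zero.mp hi])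

open PowerSeries in
/-- The identity with the quotient `(z ^ L - c ^ L) / (z - c)` written as a geometric sum, which
covers `z ≠ c` and `z = c` at once. -/
theorem sum_geom_eq {n : ℕ} (hn : 1 ≤ n) {z c : ℂ} (hz : z ≠ 0) (hc : c ≠ 0) :
    ∑ π : n.Partition, z ^ (π.largestPart + π.numParts - π.largestMult)
        * (1 - 1 / z) ^ (π.numDistinctParts - 1)
        * ∑ j ∈ Finset.range π.largestMult, z ^ j * c ^ (π.largestMult - 1 - j)
      = ∑ π : n.Partition, c ^ (π.largestPart - 1) * z ^ π.numParts
        * (1 - 1 / c) ^ (π.numDistinctParts - 1) * (π.largestMult : ℂ) := by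
  set D : ℂ → ℂ → ℕ → ℂ := fun z c m => ∑ j ∈ Finset.range m, z ^ j * c ^ (m - 1 - j) with hD
  have hDz (m : ℕ) : z * D z z m = m * z ^ m := by
    rcases m with _ | m
    · simp [hD]
    · have : ∀ j ∈ Finset.range (m + 1), z ^ j * z ^ (m + 1 - 1 - j) = z ^ m := fun j hj => by
        rw [← pow_add]
        congr 1
        have := Finset.mem_range.mp hj
        omega
      rw [hD]
      dsimp only
      rw [Finset.sum_congr rfl this]
      simp
      ring
  set e : ℂ → ℕ → ℂ⟦X⟧ := fun a i => (1 - C a * X ^ i)⁻¹ with he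
  have he1 (a : ℂ) : ∀ i, 1 ≤ i → (1 - C a * X ^ i) * e a i = 1 := fun i hi => one_sub_mul_inv a hi
  have hA (a b : ℂ) (N : ℕ) : multSeries (D a b) (N + 1)
      = X ^ (N + 1) * e a (N + 1) * e b (N + 1) := by
    have h : _ * multSeries (D a b) (N + 1) = _ :=
      one_sub_mul_one_sub_mul_multSeries a b N.add_one_ne_zero
    have h1 := he1 a (N + 1) (by omega)
    have h2 := he1 b (N + 1) (by omega)
    calc multSeries (D a b) (N + 1)
        = ((1 - C a * X ^ (N + 1)) * e a (N + 1)) * ((1 - C b * X ^ (N + 1)) * e b (N + 1))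
            * multSeries (D a b) (N + 1) := by rw [h1, h2, one_mul, one_mul]
      _ = _ := by linear_combination (e a (N + 1) * e b (N + 1)) * h
  have hB (w : ℂ) (N : ℕ) : 1 + multSeries (fun m => (1 - 1 / w) * z ^ m) (N + 1)
      = (1 - C (z / w) * X ^ (N + 1)) * e z (N + 1) := by
    rw [multSeries_const_mul _ _ N.add_one_ne_zero]
    have h := one_sub_mul_multSeries_pow z N.add_one_ne_zero
    have h1 := he1 z (N + 1) (by omega)
    have h2 : (C (z / w) : ℂ⟦X⟧) = C (1 / w) * C z := by rw [← map_mul]; congr 1; ring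
    rw [h2, map_sub, map_one]
    generalize multSeries (fun m => z ^ m) (N + 1) = S at *
    have hS : S = C z * X ^ (N + 1) * e z (N + 1) := by
      linear_combination (e z (N + 1)) * h - S * h1
    rw [hS]
    linear_combination -h1
  have hL : ∑ π : n.Partition, z ^ (π.largestPart + π.numParts - π.largestMult)
        * (1 - 1 / z) ^ (π.numDistinctParts - 1) * D z c π.largestMult
      = coeff n (∑ N ∈ Finset.range n, C z ^ (N + 1) * (X ^ (N + 1) * e z (N + 1) * e c (N + 1))
          * ∏ j ∈ Finset.range N, (1 - X ^ (j + 1)) * e z (j + 1)) := by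
    trans ∑ π : n.Partition, z ^ π.largestPart * (D z c π.largestMult
      * ∏ i ∈ π.parts.toFinset.erase π.largestPart, (1 - 1 / z) * z ^ π.parts.count i)
    · refine Finset.sum_congr rfl fun π _ => ?_
      rw [prod_erase_largestPart hn, Nat.add_sub_assoc π.largestMult_le_numParts, pow_add]
      ring
    · rw [sum_eq_coeff hn (fun m => (1 - 1 / z) * z ^ m) (D z c) (fun l => z ^ l)]
      simp only [hA, hB, div_self hz, map_one, one_mul, map_pow, mul_assoc]
  have hR : ∑ π : n.Partition, c ^ (π.largestPart - 1) * z ^ π.numParts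
        * (1 - 1 / c) ^ (π.numDistinctParts - 1) * (π.largestMult : ℂ)
      = coeff n (∑ N ∈ Finset.range n, (C z * X ^ (N + 1) * e z (N + 1) ^ 2)
          * ∏ j ∈ Finset.range N, (C c - C z * X ^ (j + 1)) * e z (j + 1)) := by
    trans ∑ π : n.Partition, c ^ (π.largestPart - 1) * (z * D z z π.largestMult
      * ∏ i ∈ π.parts.toFinset.erase π.largestPart, (1 - 1 / c) * z ^ π.parts.count i)
    · refine Finset.sum_congr rfl fun π _ => ?_
      rw [prod_erase_largestPart hn, hDz, ← Nat.add_sub_cancel' π.largestMult_le_numParts,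
        Nat.add_sub_cancel_left, pow_add]
      ring
    · rw [sum_eq_coeff hn (fun m => (1 - 1 / c) * z ^ m) (fun m => z * D z z m)
        (fun l => c ^ (l - 1))]
      congr 1
      refine Finset.sum_congr rfl fun N _ => ?_
      simp only [hB]
      rw [multSeries_const_mul _ _ N.add_one_ne_zero, hA, Nat.add_sub_cancel]
      -- The factor `c ^ N` clears the denominators of the `N` factors `1 - (z / c) X ^ j`.
      have hprod : ∏ j ∈ Finset.range N, (C c - C z * X ^ (j + 1)) * e z (j + 1)
          = C (c ^ N) * ∏ j ∈ Finset.range N, (1 - C (z / c) * X ^ (j + 1)) * e z (j + 1) := by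
        have hcz : (C z : ℂ⟦X⟧) = C c * C (z / c) := by rw [← map_mul, mul_div_cancel₀ z hc]
        rw [map_pow, ← Finset.card_range N, ← Finset.prod_const, Finset.card_range,
          ← Finset.prod_mul_distrib]
        refine Finset.prod_congr rfl fun j _ => ?_
        rw [hcz]
        ring
      rw [hprod]
      ring
  rw [hL, hR, ← sub_eq_zero, ← map_sub]
  exact X_pow_dvd_iff.mp (pow_dvd_partialSum_sub (he1 z) (he1 c) n) n (Nat.lt_succ_self n)

end Nat.Partition

theorem theorem2p15 (n : ℕ) (hn : 1 ≤ n) (z c : ℂ) (hz : z ≠ 0) (hc : c ≠ 0) :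
    (z ≠ c →
      ∑ π : n.Partition,
          z ^ (π.largestPart + π.numParts - π.largestMult)
            * (1 - 1 / z) ^ (π.numDistinctParts - 1)
            * ((z ^ π.largestMult - c ^ π.largestMult) / (z - c))
        = ∑ π : n.Partition,
          c ^ (π.largestPart - 1) * z ^ π.numParts
            * (1 - 1 / c) ^ (π.numDistinctParts - 1) * (π.largestMult : ℂ)) ∧
    (z = c →
      ∑ π : n.Partition,
          z ^ (π.largestPart + π.numParts - π.largestMult)
            * (1 - 1 / z) ^ (π.numDistinctParts - 1)
            * ((π.largestMult : ℂ) * z ^ (π.largestMult - 1))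
        = ∑ π : n.Partition,
          c ^ (π.largestPart - 1) * z ^ π.numParts
            * (1 - 1 / c) ^ (π.numDistinctParts - 1) * (π.largestMult : ℂ)) := by
  constructor
  · intro h
    rw [← Nat.Partition.sum_geom_eq hn hz hc]
    refine Finset.sum_congr rfl fun π _ => ?_
    rw [← geom_sum₂_mul, mul_div_cancel_right₀ _ (sub_ne_zero.mpr h)]
  · rintro rfl
    rw [← Nat.Partition.sum_geom_eq hn hz hc]
    refine Finset.sum_congr rfl fun π _ => ?_
    rw [geom_sum₂_self]
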